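/- Let $K$ be a field of differential functions $f=f(x,u,u_1,\dots,u_m)$: a field containing $x$ and the jet variables $u=u_0,u_1,u_2,\dots$ (with $u_i=\partial_x^i u$), equipped with commuting derivations $\partial/\partial x,\ \partial/\partial u_i$ that take the obvious values on $x$ and the $u_j$, and such that every $f\in K$ satisfies $\partial f/\partial u_i\ne 0$ for only finitely many $i$; for example the field of rational functions in $x,u,u_1,u_2,\dots$ over a field of constants. Let $D_x=\partial_x+\sum_{i\ge 0}u_{i+1}\,\partial/\partial u_i$. On solutions of $u_t=F$ with $F\in K$ put $D_t=\sum_{i\ge0}D_x^i(F)\,\partial/\partial u_i$. The Fréchet derivative of $F$ is $D_F=\sum_{i\ge0}\frac{\partial F}{\partial u_i}D_x^i$, and that of the equation $\Delta=F-u_t=0$ is $D_\Delta=-D_t+D_F$. A function $Q\in K$ is a generalized symmetry of $u_t=F$ if $\sum_{i\ge 0} D_x^i(Q)\,\partial F/\partial u_i=D_t(Q)$. The order of $f\in K$ is the largest $i$ with $\partial f/\partial u_i\neq0$. Consider the equation $u_t=u^2u_2$ and the pseudo-differential operator $$\mathcal R=u\,D_x+u^2u_2\,D_x^{-1}\cdot\frac1{u^2}.$$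 Then the following hold. 1. The Fréchet derivative of the equation is $D_\Delta=-D_t+u^2D_x^2+2uu_2$, and $\mathcal R$ commutes with it on solutions: $D_\Delta\cdot\mathcal R=\mathcal R\cdot D_\Delta$ as formal pseudo-differential operators, that is, as formal series in $D_t$ whose coefficients are formal series $\sum_{i\le m}a_iD_x^i$ with $a_i\in K$, multiplied according to $D_x\cdot a=aD_x+D_x(a)$, $D_t\cdot a=aD_t+D_t(a)$ for $a\in K$, and $D_tD_x=D_xD_t$. 2. $\mathcal R$ is a recursion operator with root $u^2u_2$ for this equation. That is, start from $Q_1=u^2u_2$ and set $Q_{j+1}=\mathcal R\,Q_j$, where $D_x^{-1}f$ denotes any $h\in K$ with $D_xh=f$. Then at each step, whichever antiderivatives were chosen before, the required antiderivative exists in $K$, and all the functions $Q_j$ obtained are generalized symmetries of $u_t=u^2u_2$. 3. The characteristics have strictly increasing orders: $\operatorname{ord}Q_1<\operatorname{ord}Q_2<\cdots$ for every such sequence. The values of $\mathcal R\,Q_1$ are exactly $$Q_2=u^2(3u_1u_2+u\,u_3)+c\,u^2u_2,\qquad c\in K,\ D_xc=0,$$ so that $Q_2=u^2(3u_1u_2+uu_3)$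 when the constant of integration is taken to be zero. -/

import Mathlib

/-!
Differential functions of `x, u, u₁, u₂, …`, total derivatives, generalized symmetries, formal
pseudo-differential operators, and recursion operators of an evolution equation `u_t = F`.
-/

/-- A field `K` of differential functions `f = f(x, u, u₁, …, u_m)`: it contains the independent
variable `x` and the jet variables `u 0 = u, u 1 = u_x, u 2 = u_xx, …`, it carries the commuting
partial derivatives with respect to all these variables, and each of its elements depends on finitely
many of the variables only. -/
class DiffFunField (K : Type*) [Field K] where
  /-- the independent variable -/
  x : K
  /-- the jet variables -/
  u : ℕ → K
  /-- `∂/∂x` -/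
  pdx : Derivation ℤ K K
  /-- `∂/∂uᵢ` -/
  pd : ℕ → Derivation ℤ K K
  pdx_x : pdx x = 1
  pdx_u : ∀ j, pdx (u j) = 0
  pd_x : ∀ i, pd i x = 0
  pd_u : ∀ i j, pd i (u j) = if i = j then 1 else 0
  pdx_pd_comm : ∀ i f, pdx (pd i f) = pd i (pdx f)
  pd_comm : ∀ i j f, pd i (pd j f) = pd j (pd i f)
  finite_pd : ∀ f, {i | pd i f ≠ 0}.Finite

namespace DiffFunField

section Jets

variable {K : Type*} [Field K] [DiffFunField K]

theorem finite_support_mul_pd (a : ℕ → K) (f : K) :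
    (Function.support fun i => a i * pd i f).Finite :=
  (finite_pd f).subset fun i hi h => hi (by simp [h])

/-- The vector field `∑ᵢ aᵢ ∂/∂uᵢ`. -/
noncomputable def vertical (a : ℕ → K) : Derivation ℤ K K :=
  Derivation.mk'
    (AddMonoidHom.toIntLinearMap
      { toFun := fun f => ∑ᶠ i, a i * pd i f
        map_zero' := by simp
        map_add' := fun f g => by
          rw [← finsum_add_distrib (finite_support_mul_pd a f) (finite_support_mul_pd a g)]
          simp [mul_add] })
    (fun f g => by
      have hf := finite_support_mul_pd a f
      have hg := finite_support_mul_pd a g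
      change ∑ᶠ i, a i * pd i (f * g) = f * ∑ᶠ i, a i * pd i g + g * ∑ᶠ i, a i * pd i f
      rw [mul_finsum, mul_finsum, ← finsum_add_distrib]
      · refine finsum_congr fun i => ?_
        rw [Derivation.leibniz, smul_eq_mul, smul_eq_mul]
        ring
      · exact hg.subset fun i hi h => hi (by simp only [h, mul_zero])
      · exact hf.subset fun i hi h => hi (by simp only [h, mul_zero]))

theorem vertical_apply (a : ℕ → K) (f : K) : vertical a f = ∑ᶠ i, a i * pd i f := rfl

variable (K) in
/-- The total derivative `D_x = ∂/∂x + ∑ᵢ uᵢ₊₁ ∂/∂uᵢ`. -/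
noncomputable def Dx : Derivation ℤ K K := pdx + vertical fun i => u (i + 1)

/-- The prolonged evolutionary vector field `P^Q = ∑ᵢ D_xⁱ(Q) ∂/∂uᵢ`. -/
noncomputable def prolong (Q : K) : Derivation ℤ K K := vertical fun i => (Dx K)^[i] Q

/-- The total `t`-derivative on the solutions of `u_t = F`, on functions that do not depend
explicitly on `t`: it replaces `∂_xⁱ u_t` by `D_xⁱ(F)`, so `D_t = ∑ᵢ D_xⁱ(F) ∂/∂uᵢ`. -/
noncomputable def Dt (F : K) : Derivation ℤ K K := vertical fun i => (Dx K)^[i] F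

/-- `Q` is (the characteristic of) a generalized symmetry of `Δ = F - u_t = 0`: the function
`P^Q(Δ) = P^Q(F) - D_t(Q)` vanishes on the solutions of `u_t = F`. -/
def IsSymmetry (F Q : K) : Prop := prolong Q F - Dt F Q = 0

/-- The order of a differential function: the largest `i` such that it depends on `uᵢ`
(and `⊥` for a function that depends on none of the `uᵢ`). -/
noncomputable def order (f : K) : WithBot ℕ := (finite_pd f).toFinset.max

end Jets

end DiffFunField

/-- Formal series `∑_{i ≤ m} aᵢ ∂ⁱ`, `m ∈ ℤ`, with coefficients `aᵢ` in a ring `A`, where the symbol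
`∂` acts on `A` through the additive map `δ` (a derivation of `A` in all uses below). -/
@[ext]
structure FormalOp (A : Type*) [NonUnitalNonAssocRing A] (δ : A →+ A) where
  coeff : ℤ → A
  bounded : ∃ m : ℤ, ∀ i, m < i → coeff i = 0

namespace FormalOp

variable {A : Type*} [NonUnitalNonAssocRing A] {δ : A →+ A}

instance : Zero (FormalOp A δ) := ⟨⟨fun _ => 0, 0, fun _ _ => rfl⟩⟩

instance : Add (FormalOp A δ) :=
  ⟨fun S T => ⟨fun i => S.coeff i + T.coeff i, by
    obtain ⟨m, hm⟩ := S.bounded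
    obtain ⟨n, hn⟩ := T.bounded
    exact ⟨max m n, fun i hi => by
      rw [hm i (lt_of_le_of_lt (le_max_left _ _) hi),
        hn i (lt_of_le_of_lt (le_max_right _ _) hi), add_zero]⟩⟩⟩

instance : Neg (FormalOp A δ) :=
  ⟨fun S => ⟨fun i => -S.coeff i, by
    obtain ⟨m, hm⟩ := S.bounded
    exact ⟨m, fun i hi => by rw [hm i hi, neg_zero]⟩⟩⟩

/-- The terms of `S T` at `∂ᵐ`, indexed by `(i, p)`, for the composition rule
`(a ∂ⁱ)(b ∂ʲ) = ∑_{p ≥ 0} (i choose p) a δᵖ(b) ∂ⁱ⁺ʲ⁻ᵖ`. -/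
def mulTerm (S T : FormalOp A δ) (m : ℤ) (s : ℤ × ℕ) : A :=
  Ring.choose s.1 s.2 • (S.coeff s.1 * δ^[s.2] (T.coeff (m - s.1 + s.2)))

theorem mulTerm_eq_zero {S T : FormalOp A δ} {a b : ℤ} (ha : ∀ i, a < i → S.coeff i = 0)
    (hb : ∀ i, b < i → T.coeff i = 0) (m : ℤ) (s : ℤ × ℕ)
    (h : a < s.1 ∨ b < m - s.1 + s.2) : mulTerm S T m s = 0 := by
  rcases h with h | h
  · simp [mulTerm, ha _ h]
  · simp [mulTerm, hb _ h, iterate_map_zero]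

theorem finite_support_mulTerm (S T : FormalOp A δ) (m : ℤ) :
    (Function.support (mulTerm S T m)).Finite := by
  obtain ⟨a, ha⟩ := S.bounded
  obtain ⟨b, hb⟩ := T.bounded
  refine ((Set.finite_Icc (m - b) a).prod (Set.finite_Iic (a + b - m).toNat)).subset ?_
  intro s hs
  by_contra hc
  apply hs
  apply mulTerm_eq_zero ha hb
  by_contra hn
  apply hc
  simp only [Set.mem_prod, Set.mem_Icc, Set.mem_Iic]
  omega

/-- Composition of formal series. -/
noncomputable instance : Mul (FormalOp A δ) :=
  ⟨fun S T => ⟨fun m => ∑ᶠ s : ℤ × ℕ, mulTerm S T m s, by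
    obtain ⟨a, ha⟩ := S.bounded
    obtain ⟨b, hb⟩ := T.bounded
    refine ⟨a + b, fun m hm => ?_⟩
    rw [finsum_eq_zero_of_forall_eq_zero]
    intro s
    apply mulTerm_eq_zero ha hb
    omega⟩⟩

theorem coeff_zero (i : ℤ) : (0 : FormalOp A δ).coeff i = 0 := rfl

theorem coeff_add (S T : FormalOp A δ) (i : ℤ) : (S + T).coeff i = S.coeff i + T.coeff i := rfl

theorem coeff_neg (S : FormalOp A δ) (i : ℤ) : (-S).coeff i = -S.coeff i := rfl

theorem coeff_mul (S T : FormalOp A δ) (m : ℤ) :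
    (S * T).coeff m = ∑ᶠ s : ℤ × ℕ, mulTerm S T m s := rfl

noncomputable instance : NonUnitalNonAssocRing (FormalOp A δ) where
  add_assoc _ _ _ := FormalOp.ext (funext fun _ => add_assoc _ _ _)
  zero_add _ := FormalOp.ext (funext fun _ => zero_add _)
  add_zero _ := FormalOp.ext (funext fun _ => add_zero _)
  add_comm _ _ := FormalOp.ext (funext fun _ => add_comm _ _)
  neg_add_cancel _ := FormalOp.ext (funext fun _ => neg_add_cancel _)
  nsmul := nsmulRec
  zsmul := zsmulRec
  left_distrib S T U := by
    ext m
    rw [coeff_add, coeff_mul, coeff_mul, coeff_mul,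
      ← finsum_add_distrib (finite_support_mulTerm S T m) (finite_support_mulTerm S U m)]
    refine finsum_congr fun s => ?_
    simp only [mulTerm, coeff_add, iterate_map_add, mul_add, smul_add]
  right_distrib S T U := by
    ext m
    rw [coeff_add, coeff_mul, coeff_mul, coeff_mul,
      ← finsum_add_distrib (finite_support_mulTerm S U m) (finite_support_mulTerm T U m)]
    refine finsum_congr fun s => ?_
    simp only [mulTerm, coeff_add, add_mul, smul_add]
  zero_mul S := by
    ext m
    rw [coeff_mul, coeff_zero]
    exact finsum_eq_zero_of_forall_eq_zero fun s => by simp [mulTerm, coeff_zero]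
  mul_zero S := by
    ext m
    rw [coeff_mul, coeff_zero]
    exact finsum_eq_zero_of_forall_eq_zero fun s => by
      simp [mulTerm, coeff_zero, iterate_map_zero]

/-- The monomial `a ∂ⁱ`. -/
def single (i : ℤ) (a : A) : FormalOp A δ where
  coeff j := if j = i then a else 0
  bounded := ⟨i, fun _ hj => if_neg hj.ne'⟩

/-- A map of `A` applied to all coefficients. -/
def mapCoeff (d : A →+ A) : FormalOp A δ →+ FormalOp A δ where
  toFun S := ⟨fun i => d (S.coeff i), by
    obtain ⟨m, hm⟩ := S.bounded
    exact ⟨m, fun i hi => by rw [hm i hi, map_zero]⟩⟩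
  map_zero' := FormalOp.ext (funext fun _ => map_zero d)
  map_add' _ _ := FormalOp.ext (funext fun _ => map_add d _ _)

end FormalOp

namespace DiffFunField

section Model

variable {A : Type*} [CommRing A] {K : Type*} [Field K] [Algebra A K]

variable (K) in
/-- The ring homomorphism `a ↦ a + ε d(a)` into the dual numbers. -/
noncomputable def dualHomAux (d : Derivation ℤ A A) : A →+* TrivSqZeroExt K K where
  toFun a := TrivSqZeroExt.inl (algebraMap A K a) + TrivSqZeroExt.inr (algebraMap A K (d a))
  map_zero' := by
    rw [map_zero, map_zero, map_zero, TrivSqZeroExt.inl_zero, TrivSqZeroExt.inr_zero, add_zero]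
  map_one' := by
    rw [Derivation.map_one_eq_zero, map_one, map_zero, TrivSqZeroExt.inl_one,
      TrivSqZeroExt.inr_zero, add_zero]
  map_add' a b := by
    rw [map_add, map_add, map_add, TrivSqZeroExt.inl_add, TrivSqZeroExt.inr_add]
    abel
  map_mul' a b := by
    apply TrivSqZeroExt.ext
    · simp only [TrivSqZeroExt.fst_add, TrivSqZeroExt.fst_mul, TrivSqZeroExt.fst_inl,
        TrivSqZeroExt.fst_inr, add_zero, map_mul]
    · simp only [TrivSqZeroExt.snd_add, TrivSqZeroExt.snd_mul, TrivSqZeroExt.snd_inl,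
        TrivSqZeroExt.snd_inr, TrivSqZeroExt.fst_add, TrivSqZeroExt.fst_inl,
        TrivSqZeroExt.fst_inr, add_zero, zero_add, op_smul_eq_smul, smul_eq_mul,
        Derivation.leibniz, map_add, map_mul]

theorem fst_dualHomAux (d : Derivation ℤ A A) (a : A) :
    (dualHomAux K d a).fst = algebraMap A K a :=
  add_zero (algebraMap A K a)

theorem snd_dualHomAux (d : Derivation ℤ A A) (a : A) :
    (dualHomAux K d a).snd = algebraMap A K (d a) :=
  zero_add (algebraMap A K (d a))

variable [IsFractionRing A K]

variable (K) in
/-- The extension of `a ↦ a + ε d(a)` to fractions. -/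
noncomputable def dualHom (d : Derivation ℤ A A) : K →+* TrivSqZeroExt K K :=
  IsLocalization.lift (M := nonZeroDivisors A) (g := dualHomAux K d) (fun y => by
    rw [TrivSqZeroExt.isUnit_iff_isUnit_fst, fst_dualHomAux]
    exact IsLocalization.map_units K y)

theorem dualHom_algebraMap (d : Derivation ℤ A A) (a : A) :
    dualHom K d (algebraMap A K a) = dualHomAux K d a :=
  IsLocalization.lift_eq _ a

theorem fst_dualHom (d : Derivation ℤ A A) (f : K) : (dualHom K d f).fst = f := by
  have h : (TrivSqZeroExt.fstHom K K K).toRingHom.comp (dualHom K d) = RingHom.id _ := by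
    apply IsLocalization.ringHom_ext (nonZeroDivisors A)
    ext a
    change (dualHom K d (algebraMap A K a)).fst = algebraMap A K a
    rw [dualHom_algebraMap, fst_dualHomAux]
  exact RingHom.congr_fun h f

variable (K) in
/-- The extension of a derivation to the field of fractions by the quotient rule. -/
noncomputable def fracDer (d : Derivation ℤ A A) : Derivation ℤ K K :=
  Derivation.mk'
    (AddMonoidHom.toIntLinearMap
      { toFun := fun f => (dualHom K d f).snd
        map_zero' := by simp
        map_add' := fun f g => by simp })
    (fun f g => by
      change (dualHom K d (f * g)).snd = f * (dualHom K d g).snd + g * (dualHom K d f).snd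
      rw [map_mul, TrivSqZeroExt.snd_mul, fst_dualHom, fst_dualHom]
      simp [mul_comm])

theorem fracDer_algebraMap (d : Derivation ℤ A A) (a : A) :
    fracDer K d (algebraMap A K a) = algebraMap A K (d a) := by
  change (dualHom K d (algebraMap A K a)).snd = _
  rw [dualHom_algebraMap, snd_dualHomAux]

theorem fracDer_mk' (d : Derivation ℤ A A) (a : A) (b : nonZeroDivisors A)
    (ha' : d a = 0) (hb' : d b = 0) : fracDer K d (IsLocalization.mk' K a b) = 0 := by
  have hb : algebraMap A K b ≠ 0 := (IsLocalization.map_units K b).ne_zero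
  have h := congrArg (fracDer K d) (IsLocalization.mk'_spec K a b)
  rw [Derivation.leibniz, fracDer_algebraMap, fracDer_algebraMap, ha', hb'] at h
  simpa [hb] using h

theorem derivation_ext_frac {D E : Derivation ℤ K K}
    (h : ∀ a : A, D (algebraMap A K a) = E (algebraMap A K a)) : D = E := by
  ext f
  obtain ⟨a, b, rfl⟩ := IsLocalization.exists_mk'_eq (nonZeroDivisors A) f
  have hb : algebraMap A K b ≠ 0 := (IsLocalization.map_units K b).ne_zero
  have h1 := congrArg D (IsLocalization.mk'_spec K a b)
  have h2 := congrArg E (IsLocalization.mk'_spec K a b)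
  rw [Derivation.leibniz] at h1 h2
  rw [h, h, ← h2] at h1
  simpa [hb] using h1

theorem fracDer_comm (d e : Derivation ℤ A A) (h : ∀ a, d (e a) = e (d a)) (f : K) :
    fracDer K d (fracDer K e f) = fracDer K e (fracDer K d f) := by
  have h1 : ⁅fracDer K d, fracDer K e⁆ = (0 : Derivation ℤ K K) := by
    apply derivation_ext_frac (A := A)
    intro a
    rw [Derivation.commutator_apply]
    simp [fracDer_algebraMap, h]
  have h2 := congrArg (fun D => D f) h1
  simpa [Derivation.commutator_apply, sub_eq_zero] using h2

theorem pderiv_comm {σ R : Type*} [CommRing R] (i j : σ) (p : MvPolynomial σ R) :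
    MvPolynomial.pderiv i (MvPolynomial.pderiv j p) =
      MvPolynomial.pderiv j (MvPolynomial.pderiv i p) := by
  classical
  have h1 : ⁅MvPolynomial.pderiv (R := R) i, MvPolynomial.pderiv j⁆ =
      (0 : Derivation R (MvPolynomial σ R) (MvPolynomial σ R)) := by
    apply MvPolynomial.derivation_ext
    intro k
    rw [Derivation.commutator_apply, MvPolynomial.pderiv_X, MvPolynomial.pderiv_X]
    by_cases h1 : k = j <;> by_cases h2 : k = i <;> simp [Pi.single_apply, h1, h2] <;>
      split_ifs <;> simp
  have h2 := congrArg (fun D => D p) h1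
  simpa [Derivation.commutator_apply, sub_eq_zero] using h2

/-- An additive map with the Leibniz rule as a derivation. -/
def intDer {B : Type*} [CommRing B] (d : B →+ B) (h : ∀ a b, d (a * b) = a • d b + b • d a) :
    Derivation ℤ B B :=
  Derivation.mk' d.toIntLinearMap h

theorem intDer_apply {B : Type*} [CommRing B] (d : B →+ B)
    (h : ∀ a b, d (a * b) = a • d b + b • d a) (p : B) : intDer d h p = d p := rfl

/-- A partial derivative as a `ℤ`-linear derivation. -/
noncomputable abbrev pderivInt {k : Type*} [CommRing k] (i : Option ℕ) :=
  intDer (B := MvPolynomial (Option ℕ) k) (MvPolynomial.pderiv i).toLinearMap.toAddMonoidHom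
    (fun a b => (MvPolynomial.pderiv i).leibniz a b)

theorem pderivInt_apply {k : Type*} [CommRing k] (i : Option ℕ) (p : MvPolynomial (Option ℕ) k) :
    pderivInt i p = MvPolynomial.pderiv i p := rfl

theorem pderivInt_comm {k : Type*} [CommRing k] (i j : Option ℕ)
    (p : MvPolynomial (Option ℕ) k) :
    pderivInt i (pderivInt j p) = pderivInt j (pderivInt i p) :=
  pderiv_comm i j p

theorem fracDer_pderivInt_X {k : Type*} [CommRing k] [Algebra (MvPolynomial (Option ℕ) k) K]
    [IsFractionRing (MvPolynomial (Option ℕ) k) K] (i j : Option ℕ) :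
    fracDer K (pderivInt (k := k) i)
        (algebraMap (MvPolynomial (Option ℕ) k) K (MvPolynomial.X j)) =
      if i = j then 1 else 0 := by
  refine (fracDer_algebraMap (pderivInt (k := k) i) (MvPolynomial.X j)).trans ?_
  rw [pderivInt_apply]
  split_ifs with h
  · rw [h, MvPolynomial.pderiv_X_self, map_one]
  · rw [MvPolynomial.pderiv_X_of_ne (Ne.symm h), map_zero]

/-- The field `K = k(x, u, u₁, u₂, …)` of rational differential functions over a field `k` of
constants is a field of differential functions. -/
@[reducible]
noncomputable def rationalFunctions (k K : Type*) [Field k] [Field K]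
    [Algebra (MvPolynomial (Option ℕ) k) K] [IsFractionRing (MvPolynomial (Option ℕ) k) K] :
    DiffFunField K where
  x := algebraMap (MvPolynomial (Option ℕ) k) _ (MvPolynomial.X none)
  u i := algebraMap (MvPolynomial (Option ℕ) k) _ (MvPolynomial.X (some i))
  pdx := fracDer K (pderivInt (k := k) none)
  pd i := fracDer K (pderivInt (k := k) (some i))
  pdx_x := (fracDer_pderivInt_X (k := k) none none).trans (if_pos rfl)
  pdx_u j := (fracDer_pderivInt_X (k := k) none (some j)).trans (if_neg (by simp))
  pd_x i := (fracDer_pderivInt_X (k := k) (some i) none).trans (if_neg (by simp))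
  pd_u i j := (fracDer_pderivInt_X (k := k) (some i) (some j)).trans (by simp)
  pdx_pd_comm i f :=
    fracDer_comm (pderivInt none) (pderivInt (some i)) (pderivInt_comm none (some i)) f
  pd_comm i j f :=
    fracDer_comm (pderivInt (some i)) (pderivInt (some j)) (pderivInt_comm (some i) (some j)) f
  finite_pd f := by
    classical
    obtain ⟨a, b, rfl⟩ := IsLocalization.exists_mk'_eq
      (nonZeroDivisors (MvPolynomial (Option ℕ) k)) f
    refine ((a.vars ∪ b.1.vars).finite_toSet.preimage
      (Option.some_injective ℕ).injOn).subset fun i hi => ?_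
    by_contra h
    simp only [Set.mem_preimage, Finset.mem_coe, Finset.mem_union, not_or] at h
    have ha : pderivInt (some i) a = 0 := MvPolynomial.pderiv_eq_zero_of_notMem_vars h.1
    have hb : pderivInt (some i) b.1 = 0 := MvPolynomial.pderiv_eq_zero_of_notMem_vars h.2
    exact hi (fracDer_mk' (pderivInt (some i)) a b ha hb)

end Model

section Operators

variable (K : Type*) [Field K] [DiffFunField K]

/-- Formal pseudo-differential operators: formal series in `D_x` with coefficients in `K`. -/
abbrev PseudoDiff : Type _ := FormalOp K (Dx K).toLinearMap.toAddMonoidHom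

variable {K}

/-- Operators in `D_x` and `D_t` on the solutions of `u_t = F`: formal series in `D_t` whose
coefficients are formal series in `D_x`. Here `[D_t, D_x] = 0` and `[D_t, f] = D_t(f)` for `f` in `K`,
that is, `[D_t, ∑ aᵢ D_xⁱ] = ∑ D_t(aᵢ) D_xⁱ`. -/
abbrev SolOp (F : K) : Type _ :=
  FormalOp (PseudoDiff K) (FormalOp.mapCoeff (Dt F).toLinearMap.toAddMonoidHom)

/-- The Fréchet derivative `∑ᵢ (∂H/∂uᵢ) D_xⁱ` of a differential function `H`. -/
noncomputable def frechet (H : K) : PseudoDiff K where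
  coeff i := if 0 ≤ i then pd i.toNat H else 0
  bounded := by
    obtain ⟨n, hn⟩ := (finite_pd H).bddAbove
    refine ⟨n, fun i hi => ?_⟩
    rw [if_pos (by omega)]
    by_contra h
    have := hn h
    omega

/-- The Fréchet derivative `D_Δ = -D_t + D_F` of `Δ = F - u_t`, as an operator on solutions. -/
noncomputable def frechetEq (F : K) : SolOp F :=
  -FormalOp.single 1 (FormalOp.single 0 1) + FormalOp.single 0 (frechet F)

variable (K) in
/-- Pseudo-differential expressions, built from multiplications by functions, `D_x` and `D_x⁻¹`
with sums and compositions. -/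
inductive Expr : Type _
  | fn (f : K)
  | dx
  | dxInv
  | add (S T : Expr)
  | comp (S T : Expr)

/-- The formal pseudo-differential operator that an expression denotes. -/
noncomputable def Expr.toOp : Expr K → PseudoDiff K
  | .fn f => FormalOp.single 0 f
  | .dx => FormalOp.single 1 1
  | .dxInv => FormalOp.single (-1) 1
  | .add S T => S.toOp + T.toOp
  | .comp S T => S.toOp * T.toOp

/-- `R.Acts Q Q'`: the differential function `Q'` is a value of `R Q`. As `D_x⁻¹ f` stands for any
differential function `h` with `D_x h = f`, an expression may have several values or none. -/
def Expr.Acts : Expr K → K → K → Prop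
  | .fn f, Q, Q' => Q' = f * Q
  | .dx, Q, Q' => Q' = Dx K Q
  | .dxInv, Q, Q' => Dx K Q' = Q
  | .add S T, Q, Q' => ∃ a b, S.Acts Q a ∧ T.Acts Q b ∧ Q' = a + b
  | .comp S T, Q, Q' => ∃ a, T.Acts Q a ∧ S.Acts a Q'

/-- `R` is a recursion operator with root `Q₁` for `u_t = F`: repeated application of `R` to `Q₁`
never breaks down and yields generalized symmetries only, whichever antiderivatives are chosen. -/
def IsRecursionOperator (F : K) (R : Expr K) (Q₁ : K) : Prop :=
  ∀ Q, Relation.ReflTransGen R.Acts Q₁ Q → IsSymmetry F Q ∧ ∃ Q', R.Acts Q Q'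

variable (K) in
/-- The expression `u D_x + u² u₂ D_x⁻¹ · (1/u²)`. -/
def recOp : Expr K :=
  .add (.comp (.fn (u 0)) .dx) (.comp (.fn (u 0 ^ 2 * u 2)) (.comp .dxInv (.fn (1 / u 0 ^ 2))))

end Operators

end DiffFunField

open DiffFunField

namespace DiffFunField

/-! ### Jet calculus: commutators of partial and total derivatives -/

section JetCalculus

variable {K : Type*} [Field K] [DiffFunField K]

/-! Write F = u² u₂. The symmetries are controlled by potentials: every iterate is Q = u² D_x w with
D_t w = D_x Q, starting from w = u₁. The values of D_x⁻¹(Q/u²) are then exactly w + c with D_x c =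
0, so the recursion never breaks down, and R Q = u² D_x(u D_x w + u₁(w + c)), where the new
potential satisfies the same equation (`recOp_acts_potential`, `Dt_eq_potential_step`). Since D_t
and D_x commute (`Dt_Dx`), that equation makes Q a symmetry (`isSymmetry_of_Dt_eq`). The operator
identity D_Δ R = R D_Δ is not needed for this.

Orders follow from [∂/∂uₙ₊₁, D_x] = ∂/∂uₙ (`pd_succ_Dx`): u D_x raises the order by one, while the
nonlocal term cannot reach the new top order (`recOp_acts_leading`).

The operator identity reduces to [D_F, R] = D_t(R) (`frechetEq_mul_eq`, `frechet_mul_recOp`). It is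
checked by moving D_x to the right and cancelling D_x D_x⁻¹. Associativity is needed only when the
leftmost factor is a function, ∂ or ∂⁻¹, so the full associative law for formal series is bypassed.
-/

theorem exists_pd_eq_zero (f : K) : ∃ N, ∀ i, N ≤ i → pd i f = 0 := by
  obtain ⟨n, hn⟩ := (finite_pd f).bddAbove
  refine ⟨n + 1, fun i hi => ?_⟩
  by_contra h
  have := hn h
  omega

theorem vertical_eq_sum (a : ℕ → K) {f : K} {N : ℕ} (hN : ∀ i, N ≤ i → pd i f = 0) :
    vertical a f = ∑ i ∈ Finset.range N, a i * pd i f := by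
  rw [vertical_apply]
  refine finsum_eq_sum_of_support_subset _ fun i hi => ?_
  by_contra h
  apply hi
  simp only [Finset.coe_range, Set.mem_Iio, not_lt] at h
  simp [hN i h]

theorem vertical_u (a : ℕ → K) (j : ℕ) : vertical a (u j) = a j := by
  rw [vertical_apply, finsum_eq_single _ j]
  · simp [pd_u]
  · intro i hi
    simp [pd_u, hi]

theorem Dx_u (j : ℕ) : Dx K (u j) = u (j + 1) := by
  change pdx (u j : K) + vertical _ (u j) = _
  rw [pdx_u, vertical_u, zero_add]

theorem Dx_eq_sum {f : K} {N : ℕ} (hN : ∀ i, N ≤ i → pd i f = 0) :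
    Dx K f = pdx f + ∑ i ∈ Finset.range N, u (i + 1) * pd i f := by
  rw [← vertical_eq_sum (fun i => u (i + 1)) hN]
  rfl

theorem pd_Dx_aux (i : ℕ) (f : K) {N : ℕ} (hN : ∀ i, N ≤ i → pd i f = 0) :
    pd i (Dx K f) =
      ∑ j ∈ Finset.range N, (if i = j + 1 then pd j f else 0) + Dx K (pd i f) := by
  rw [Dx_eq_sum hN, Dx_eq_sum (f := pd i f) (N := N) fun j hj => by rw [pd_comm, hN j hj, map_zero]]
  rw [map_add, map_sum, pdx_pd_comm, add_left_comm, ← Finset.sum_add_distrib]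
  congr 1
  refine Finset.sum_congr rfl fun j _ => ?_
  rw [Derivation.leibniz, pd_u, pd_comm i j]
  simp only [smul_eq_mul, mul_ite, mul_one, mul_zero]
  ring

theorem pd_zero_Dx (f : K) : pd 0 (Dx K f) = Dx K (pd 0 f) := by
  obtain ⟨N, hN⟩ := exists_pd_eq_zero f
  rw [pd_Dx_aux 0 f hN]
  simp

theorem pd_succ_Dx (n : ℕ) (f : K) : pd (n + 1) (Dx K f) = pd n f + Dx K (pd (n + 1) f) := by
  obtain ⟨N, hN⟩ := exists_pd_eq_zero f
  rw [pd_Dx_aux (n + 1) f hN]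
  congr 1
  simp only [add_left_inj, Finset.sum_ite_eq, Finset.mem_range]
  split_ifs with h
  · rfl
  · exact (hN n (not_lt.mp h)).symm

/-- Because [∂/∂uᵢ₊₁, D_x] = ∂/∂uᵢ, the commutator terms aᵢ₊₁ ∂f/∂uᵢ match the terms D_x(aᵢ) ∂f/∂uᵢ
produced by the Leibniz rule on the other side. -/
theorem vertical_Dx {a : ℕ → K} (ha : ∀ i, Dx K (a i) = a (i + 1)) (f : K) :
    vertical a (Dx K f) = Dx K (vertical a f) := by
  obtain ⟨N, hN⟩ := exists_pd_eq_zero f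
  have hN' : ∀ i, N + 1 ≤ i → pd i (Dx K f) = 0 := by
    intro i hi
    obtain ⟨j, rfl⟩ : ∃ j, i = j + 1 := ⟨i - 1, by omega⟩
    rw [pd_succ_Dx, hN j (by omega), hN (j + 1) (by omega), map_zero, add_zero]
  -- `Dx K f` may involve one jet variable more than f; the extra boundary term, at index N,
  -- vanishes.
  have h1 : ∑ i ∈ Finset.range N, a (i + 1) * Dx K (pd (i + 1) f) + a 0 * Dx K (pd 0 f) =
      ∑ i ∈ Finset.range N, a i * Dx K (pd i f) := by
    rw [← Finset.sum_range_succ' (fun i => a i * Dx K (pd i f)), Finset.sum_range_succ,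
      hN N le_rfl, map_zero, mul_zero, add_zero]
  rw [vertical_eq_sum a hN', vertical_eq_sum a hN, Finset.sum_range_succ', pd_zero_Dx, map_sum]
  simp only [pd_succ_Dx, Derivation.leibniz, smul_eq_mul, ha, mul_add, Finset.sum_add_distrib]
  rw [add_assoc, h1, add_comm]
  congr 1
  exact Finset.sum_congr rfl fun i _ => mul_comm _ _

theorem Dt_Dx (F f : K) : Dt F (Dx K f) = Dx K (Dt F f) :=
  vertical_Dx (fun i => (Function.iterate_succ_apply' _ i F).symm) f

theorem Dt_u (F : K) (j : ℕ) : Dt F (u j) = (Dx K)^[j] F := vertical_u _ j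

theorem u_ne_zero (j : ℕ) : (u j : K) ≠ 0 := by
  intro h
  have h1 := pd_u (K := K) j j
  rw [h, map_zero, if_pos rfl] at h1
  exact zero_ne_one h1

/-- Descending induction on i: once ∂f/∂uᵢ₊₁ = 0, the commutator formula gives ∂f/∂uᵢ = ∂(D_x
f)/∂uᵢ₊₁. It bounds the order of antiderivatives, and shows that constants of integration depend on
no jet variable. -/
theorem pd_eq_zero_of_Dx {f : K} {n : ℕ} (h : ∀ i, n < i → pd i (Dx K f) = 0) (i : ℕ)
    (hi : n ≤ i) : pd i f = 0 := by
  obtain ⟨N, hN⟩ := exists_pd_eq_zero f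
  have key : ∀ k i, n ≤ i → N ≤ i + k → pd i f = 0 := by
    intro k
    induction k with
    | zero => exact fun i _ hk => hN i hk
    | succ k ih =>
      intro i hi hk
      have h1 := pd_succ_Dx i f
      rw [h (i + 1) (by omega), ih (i + 1) (by omega) (by omega), map_zero, add_zero] at h1
      exact h1.symm
  exact key N i hi (by omega)

theorem pd_eq_zero_of_Dx_eq_zero {c : K} (h : Dx K c = 0) (i : ℕ) : pd i c = 0 :=
  pd_eq_zero_of_Dx (n := 0) (fun j _ => by rw [h, map_zero]) i (Nat.zero_le i)

theorem vertical_eq_zero_of_Dx_eq_zero (a : ℕ → K) {c : K} (h : Dx K c = 0) : vertical a c = 0 := by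
  rw [vertical_apply]
  exact finsum_eq_zero_of_forall_eq_zero fun i => by rw [pd_eq_zero_of_Dx_eq_zero h, mul_zero]

theorem order_eq_of_pd {f : K} {n : ℕ} (hn : pd n f ≠ 0) (h : ∀ i, n < i → pd i f = 0) :
    order f = n := by
  refine le_antisymm (Finset.max_le fun i hi => ?_) (Finset.le_max (by simpa using hn))
  rw [Set.Finite.mem_toFinset] at hi
  by_contra hlt
  exact hi (h i (WithBot.coe_lt_coe.1 (not_le.1 hlt)))

/-! ### Action of R on functions: potentials, symmetries, orders -/

theorem recOp_acts_iff (Q Q' : K) : (recOp K).Acts Q Q' ↔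
    ∃ h, u 0 ^ 2 * Dx K h = Q ∧ Q' = u 0 * Dx K Q + u 0 ^ 2 * u 2 * h := by
  have hu : (u 0 : K) ≠ 0 := u_ne_zero 0
  constructor
  · rintro ⟨a, b, ⟨a', rfl, rfl⟩, ⟨h, ⟨g, rfl, hg⟩, rfl⟩, rfl⟩
    refine ⟨h, ?_, rfl⟩
    change Dx K h = _ at hg
    rw [hg]
    field_simp
  · rintro ⟨h, h1, rfl⟩
    refine ⟨_, _, ⟨_, rfl, rfl⟩, ⟨h, ⟨_, rfl, ?_⟩, rfl⟩, rfl⟩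
    change Dx K h = _
    rw [← h1]
    field_simp

theorem Dx_pow_two (f : K) : Dx K (f ^ 2) = 2 * f * Dx K f := by
  rw [pow_two, Derivation.leibniz, smul_eq_mul]
  ring

theorem pd_rhs (i : ℕ) : pd i (u 0 ^ 2 * u 2 : K) =
    (if i = 2 then u 0 ^ 2 else 0) + (if i = 0 then 2 * u 0 * u 2 else 0) := by
  rw [pow_two]
  simp only [Derivation.leibniz, pd_u, smul_eq_mul]
  split_ifs <;> ring

theorem Dt_rhs (f : K) : vertical (fun i => (Dx K)^[i] f) (u 0 ^ 2 * u 2) =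
    u 0 ^ 2 * Dx K (Dx K f) + 2 * u 0 * u 2 * f := by
  rw [pow_two]
  simp only [Derivation.leibniz, vertical_u, smul_eq_mul, Function.iterate_succ_apply',
    Function.iterate_zero_apply]
  ring

/-- If `D_t w = D_x (u² D_x w)` on solutions of `u_t = u² u₂`, then `u² D_x w` is a symmetry. -/
theorem isSymmetry_of_Dt_eq {w : K}
    (hw : Dt (u 0 ^ 2 * u 2) w = Dx K (u 0 ^ 2 * Dx K w)) :
    IsSymmetry (u 0 ^ 2 * u 2) (u 0 ^ 2 * Dx K w) := by
  rw [IsSymmetry, sub_eq_zero]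
  refine (Dt_rhs _).trans ?_
  have h : ∀ D : Derivation ℤ K K, D (u 0 ^ 2 * Dx K w) =
      2 * u 0 * D (u 0) * Dx K w + u 0 ^ 2 * D (Dx K w) := fun D => by
    rw [pow_two]
    simp only [Derivation.leibniz, smul_eq_mul]
    ring
  rw [h (Dt _), Dt_u, Dt_Dx, hw, Function.iterate_zero_apply]
  ring

/-- Any antiderivative of Q/u² = D_x w differs from w by a constant c. Then u D_x(u² D_x w) + u²
u₂(w + c) acquires the factor u², and the cofactor is a total derivative. -/
theorem recOp_acts_potential {w Q' : K} (h : (recOp K).Acts (u 0 ^ 2 * Dx K w) Q') :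
    ∃ c, Dx K c = 0 ∧ Q' = u 0 ^ 2 * Dx K (u 0 * Dx K w + u 1 * (w + c)) := by
  obtain ⟨v, h1, rfl⟩ := (recOp_acts_iff _ _).1 h
  have hv : Dx K v = Dx K w := mul_left_cancel₀ (pow_ne_zero 2 (u_ne_zero 0)) h1
  refine ⟨v - w, by rw [map_sub, hv, sub_self], ?_⟩
  simp only [Derivation.leibniz, map_add, map_sub, hv, Dx_pow_two, Dx_u, smul_eq_mul]
  ring

theorem Dt_eq_potential_step {w c : K} (hc : Dx K c = 0)
    (hw : Dt (u 0 ^ 2 * u 2) w = Dx K (u 0 ^ 2 * Dx K w)) :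
    Dt (u 0 ^ 2 * u 2) (u 0 * Dx K w + u 1 * (w + c)) =
      Dx K (u 0 ^ 2 * Dx K (u 0 * Dx K w + u 1 * (w + c))) := by
  have hc' : Dt (u 0 ^ 2 * u 2) c = 0 := vertical_eq_zero_of_Dx_eq_zero _ hc
  simp only [map_add, Derivation.leibniz, hc', Dt_Dx, Dt_u, hw, Function.iterate_succ_apply',
    Function.iterate_zero_apply, Dx_u, hc, smul_eq_mul, Dx_pow_two, map_zero]
  have h2 : Dx K (2 : K) = 0 := by simpa using (Dx K).map_natCast 2
  simp only [h2]
  ring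

theorem exists_potential {Q : K}
    (h : Relation.ReflTransGen (recOp K).Acts (u 0 ^ 2 * u 2) Q) :
    ∃ w, Q = u 0 ^ 2 * Dx K w ∧ Dt (u 0 ^ 2 * u 2) w = Dx K (u 0 ^ 2 * Dx K w) := by
  induction h with
  -- For w = u₁ the evolution equation is the differentiated equation D_t u₁ = D_x F.
  | refl => exact ⟨u 1, by rw [Dx_u], by rw [Dt_u, Dx_u]; rfl⟩
  | tail _ hstep ih =>
    obtain ⟨w, rfl, hw⟩ := ih
    obtain ⟨c, hc, rfl⟩ := recOp_acts_potential hstep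
    exact ⟨_, rfl, Dt_eq_potential_step hc hw⟩

theorem isRecursionOperator_recOp :
    IsRecursionOperator (u 0 ^ 2 * u 2 : K) (recOp K) (u 0 ^ 2 * u 2) := by
  intro Q hQ
  obtain ⟨w, rfl, hw⟩ := exists_potential hQ
  -- The potential itself serves as the required antiderivative.
  exact ⟨isSymmetry_of_Dt_eq hw, _, (recOp_acts_iff _ _).2 ⟨w, rfl, rfl⟩⟩

/-- The antiderivative v of Q/u² has order below n, so u² u₂ v involves no uᵢ with i > n, given n ≥
2. Hence the top derivative of R Q comes from u D_x Q alone and equals u ∂Q/∂uₙ. -/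
theorem recOp_acts_leading {Q Q' : K} {n : ℕ} (hn : 2 ≤ n) (hQ : pd n Q ≠ 0)
    (hQ0 : ∀ i, n < i → pd i Q = 0) (h : (recOp K).Acts Q Q') :
    pd (n + 1) Q' ≠ 0 ∧ ∀ i, n + 1 < i → pd i Q' = 0 := by
  have hu : (u 0 : K) ≠ 0 := u_ne_zero 0
  obtain ⟨v, h1, rfl⟩ := (recOp_acts_iff _ _).1 h
  have hv : ∀ i, n ≤ i → pd i v = 0 := by
    refine pd_eq_zero_of_Dx fun i hi => ?_
    have h2 := hQ0 i hi
    rw [← h1, pow_two] at h2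
    simpa [Derivation.leibniz, pd_u, show i ≠ 0 by omega, hu] using h2
  have key : ∀ i, n < i → pd i (u 0 * Dx K Q + u 0 ^ 2 * u 2 * v) = u 0 * pd i (Dx K Q) := by
    intro i hi
    rw [map_add, Derivation.leibniz, Derivation.leibniz, pd_rhs, pd_u, hv i hi.le]
    simp [show i ≠ 0 by omega, show i ≠ 2 by omega]
  constructor
  · rw [key _ (by omega), pd_succ_Dx, hQ0 (n + 1) (by omega), map_zero, add_zero]
    exact mul_ne_zero hu hQ
  · intro i hi
    obtain ⟨j, rfl⟩ : ∃ j, i = j + 1 := ⟨i - 1, by omega⟩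
    rw [key _ (by omega), pd_succ_Dx, hQ0 (j + 1) (by omega), hQ0 j (by omega), map_zero,
      add_zero, mul_zero]

theorem strictMono_order {Q : ℕ → K} (h0 : Q 0 = u 0 ^ 2 * u 2)
    (hQ : ∀ j, (recOp K).Acts (Q j) (Q (j + 1))) : StrictMono fun j => order (Q j) := by
  -- The order is exactly j + 2, indexing from `Q 0` of order 2.
  have key : ∀ j, pd (j + 2) (Q j) ≠ 0 ∧ ∀ i, j + 2 < i → pd i (Q j) = 0 := by
    intro j
    induction j with
    | zero =>
      refine ⟨?_, fun i hi => ?_⟩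
      · rw [h0, pd_rhs]
        simp [u_ne_zero]
      · rw [h0, pd_rhs, if_neg (by omega), if_neg (by omega), add_zero]
    | succ j ih => exact recOp_acts_leading (by omega) ih.1 ih.2 (hQ j)
  refine strictMono_nat_of_lt_succ fun j => ?_
  rw [order_eq_of_pd (key j).1 (key j).2, order_eq_of_pd (key (j + 1)).1 (key (j + 1)).2]
  exact_mod_cast Nat.lt_succ_self (j + 2)

theorem recOp_acts_root_iff (Q₂ : K) : (recOp K).Acts (u 0 ^ 2 * u 2) Q₂ ↔
    ∃ c : K, Dx K c = 0 ∧
      Q₂ = u 0 ^ 2 * (3 * u 1 * u 2 + u 0 * u 3) + c * (u 0 ^ 2 * u 2) := by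
  rw [recOp_acts_iff]
  constructor
  · rintro ⟨v, h1, rfl⟩
    have hv : Dx K v = u 2 := mul_left_cancel₀ (pow_ne_zero 2 (u_ne_zero 0)) h1
    refine ⟨v - u 1, by rw [map_sub, hv, Dx_u, sub_self], ?_⟩
    simp only [Derivation.leibniz, Dx_pow_two, Dx_u, smul_eq_mul]
    ring
  · rintro ⟨c, hc, rfl⟩
    refine ⟨u 1 + c, by rw [map_add, hc, add_zero, Dx_u], ?_⟩
    simp only [Derivation.leibniz, Dx_pow_two, Dx_u, smul_eq_mul]
    ring

end JetCalculus

end DiffFunField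

namespace FormalOp

/-! ### Composition with monomials on the left -/

section General

variable {A : Type*} [NonUnitalNonAssocRing A] {δ : A →+ A}

theorem coeff_single (i : ℤ) (a : A) (j : ℤ) :
    (single i a : FormalOp A δ).coeff j = if j = i then a else 0 := rfl

theorem coeff_mapCoeff (d : A →+ A) (S : FormalOp A δ) (i : ℤ) :
    (mapCoeff d S).coeff i = d (S.coeff i) := rfl

theorem coeff_single_zero_mul (a : A) (S : FormalOp A δ) (m : ℤ) :
    (single 0 a * S).coeff m = a * S.coeff m := by
  rw [coeff_mul, finsum_eq_single _ ((0 : ℤ), 0)]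
  · simp [mulTerm, coeff_single]
  · rintro ⟨i, p⟩ h
    by_cases hi : i = 0
    · subst hi
      have hp : p ≠ 0 := fun hp => h (by rw [hp])
      simp [mulTerm, Ring.choose_zero_pos ℤ (Nat.pos_of_ne_zero hp)]
    · simp [mulTerm, coeff_single, hi]

theorem coeff_single_one_mul (a : A) (S : FormalOp A δ) (m : ℤ) :
    (single 1 a * S).coeff m = a * S.coeff (m - 1) + a * δ (S.coeff m) := by
  rw [coeff_mul, finsum_eq_sum_of_support_subset (s := {((1 : ℤ), 0), ((1 : ℤ), 1)})]
  · rw [Finset.sum_pair (by simp)]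
    simp [mulTerm, coeff_single]
  · rintro ⟨i, p⟩ h
    by_contra hc
    apply h
    by_cases hi : i = 1
    · subst hi
      have hp : 1 < p := by
        by_contra hp
        interval_cases p <;> simp at hc
      have h1 : Ring.choose (1 : ℤ) p = 0 := by
        have := Ring.choose_natCast (R := ℤ) 1 p
        rw [Nat.choose_eq_zero_of_lt hp] at this
        simpa using this
      simp [mulTerm, h1]
    · simp [mulTerm, coeff_single, hi]

end General

/-! ### Partial associativity and the inverse of ∂ -/

section Derivation

variable {A : Type*} [CommRing A] {d : Derivation ℤ A A}

local notation "Op" => FormalOp A d.toLinearMap.toAddMonoidHom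

theorem mul_single_zero_one (S : Op) : S * single 0 1 = S := by
  ext m
  rw [coeff_mul, finsum_eq_single _ (m, 0)]
  · simp [mulTerm, coeff_single]
  · rintro ⟨i, p⟩ h
    rcases p with _ | p
    · have hi : ¬ m - i = 0 := fun hi => h (by rw [Prod.mk.injEq]; exact ⟨by omega, rfl⟩)
      simp [mulTerm, coeff_single, hi]
    · have h1 : d.toLinearMap.toAddMonoidHom
          ((single 0 1 : Op).coeff (m - i + ((p + 1 : ℕ) : ℤ))) = 0 := by
        rw [coeff_single]
        split_ifs
        · exact d.map_one_eq_zero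
        · exact map_zero _
      simp only [mulTerm, Function.iterate_succ_apply, h1, iterate_map_zero, mul_zero, smul_zero]

theorem single_zero_one_mul (S : Op) : single 0 1 * S = S := by
  ext m
  rw [coeff_single_zero_mul, one_mul]

theorem single_zero_mul_mul (a : A) (S T : Op) : single 0 a * S * T = single 0 a * (S * T) := by
  ext m
  rw [coeff_single_zero_mul, coeff_mul, coeff_mul, mul_finsum' _ _ (finite_support_mulTerm S T m)]
  refine finsum_congr fun s => ?_
  simp only [mulTerm, coeff_single_zero_mul, zsmul_eq_mul]
  ring

/-- Composition with a derivation of the coefficients that commutes with the symbol's. -/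
theorem mapCoeff_mul (e : Derivation ℤ A A) (h : ∀ a, e (d a) = d (e a)) (S T : Op) :
    mapCoeff e.toLinearMap.toAddMonoidHom (S * T) =
      mapCoeff e.toLinearMap.toAddMonoidHom S * T +
        S * mapCoeff e.toLinearMap.toAddMonoidHom T := by
  have hit : ∀ (p : ℕ) a, e (d.toLinearMap.toAddMonoidHom^[p] a) =
      d.toLinearMap.toAddMonoidHom^[p] (e a) := fun p =>
    (Function.Commute.iterate_right (f := e) (g := d.toLinearMap.toAddMonoidHom) h p)
  ext m
  rw [coeff_add, coeff_mapCoeff, coeff_mul, coeff_mul, coeff_mul,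
    ← finsum_add_distrib (finite_support_mulTerm _ _ m) (finite_support_mulTerm _ _ m),
    AddMonoidHom.map_finsum _ (finite_support_mulTerm S T m)]
  refine finsum_congr fun s => ?_
  simp only [mulTerm, coeff_mapCoeff]
  change e _ = _ • (e _ * _) + _ • (_ * _^[s.2] (e _))
  rw [map_zsmul, Derivation.leibniz, hit, ← smul_add, smul_eq_mul, smul_eq_mul]
  ring_nf

/-- The series `∑ aᵢ ∂ⁱ⁺¹`. -/
def shift (S : Op) : Op where
  coeff i := S.coeff (i - 1)
  bounded := by
    obtain ⟨m, hm⟩ := S.bounded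
    exact ⟨m + 1, fun i hi => hm _ (by omega)⟩

theorem coeff_shift (S : Op) (i : ℤ) : (shift S).coeff i = S.coeff (i - 1) := rfl

theorem finite_support_smul_mul (c : ℤ × ℕ → ℤ) (S T : Op) (m : ℤ) :
    (Function.support fun s : ℤ × ℕ => c s •
      (S.coeff s.1 * d.toLinearMap.toAddMonoidHom^[s.2] (T.coeff (m - s.1 + s.2)))).Finite := by
  obtain ⟨a, ha⟩ := S.bounded
  obtain ⟨b, hb⟩ := T.bounded
  refine ((Set.finite_Icc (m - b) a).prod (Set.finite_Iic (a + b - m).toNat)).subset ?_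
  rintro ⟨i, p⟩ hs
  have h1 : i ≤ a := by
    by_contra h
    exact hs (by simp [ha i (not_le.1 h)])
  have h2 : m - i + p ≤ b := by
    by_contra h
    exact hs (by simp [hb _ (not_le.1 h), iterate_map_zero])
  simp only [Set.mem_prod, Set.mem_Icc, Set.mem_Iic]
  omega

/-- This is (S∂)T = S(∂T) with ∂T = T∂ + δ(T), and amounts to Pascal's rule for the generalized
binomial coefficients. -/
theorem shift_mul (S T : Op) : shift S * T =
    shift (S * T) + S * mapCoeff d.toLinearMap.toAddMonoidHom T := by
  ext m
  have e1 : (shift S * T).coeff m = ∑ᶠ s : ℤ × ℕ, Ring.choose (s.1 + 1) s.2 •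
      (S.coeff s.1 * d.toLinearMap.toAddMonoidHom^[s.2] (T.coeff (m - 1 - s.1 + s.2))) := by
    rw [coeff_mul, ← finsum_comp_equiv ((Equiv.addRight (1 : ℤ)).prodCongr (Equiv.refl ℕ))]
    refine finsum_congr fun s => ?_
    simp [mulTerm, coeff_shift, sub_sub, add_comm]
  have e2 : (S * mapCoeff d.toLinearMap.toAddMonoidHom T).coeff m = ∑ᶠ s : ℤ × ℕ,
      (Ring.choose (s.1 + 1) s.2 - Ring.choose s.1 s.2) •
      (S.coeff s.1 * d.toLinearMap.toAddMonoidHom^[s.2] (T.coeff (m - 1 - s.1 + s.2))) := by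
    have hinj : Function.Injective fun s : ℤ × ℕ => (s.1, s.2 + 1) := by
      rintro ⟨i, p⟩ ⟨j, q⟩ h
      simpa using h
    rw [coeff_mul]
    symm
    -- In the difference of binomials the index is p + 1, where Pascal's rule leaves (i choose p);
    -- at p = 0 the difference is 1 - 1 = 0.
    rw [← finsum_mem_univ, finsum_mem_inter_support_eq _ (t := Set.range
      fun s : ℤ × ℕ => (s.1, s.2 + 1)), finsum_mem_range hinj]
    · refine finsum_congr fun s => ?_
      rw [mulTerm, coeff_mapCoeff, ← Function.iterate_succ_apply, Ring.choose_succ_succ,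
        add_sub_cancel_right]
      congr 4
      push_cast
      ring
    · ext ⟨i, p⟩
      simp only [Set.univ_inter, Set.mem_inter_iff, Set.mem_range, iff_and_self]
      intro h
      rcases p with _ | p
      · simp at h
      · exact ⟨(i, p), rfl⟩
  rw [coeff_add, coeff_shift, e1, e2, coeff_mul, ← finsum_add_distrib (finite_support_mulTerm _ _ _)]
  · refine finsum_congr fun s => ?_
    rw [mulTerm, ← add_smul, add_sub_cancel]
  · exact finite_support_smul_mul _ S T (m - 1)

theorem single_one_one_mul_eq (S : Op) : single 1 1 * S =
    shift S + mapCoeff d.toLinearMap.toAddMonoidHom S := by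
  ext m
  rw [coeff_single_one_mul, coeff_add, one_mul, one_mul]
  rfl

theorem single_one_one_mul_mul (S T : Op) : single 1 1 * S * T = single 1 1 * (S * T) := by
  rw [single_one_one_mul_eq, single_one_one_mul_eq, right_distrib, shift_mul,
    mapCoeff_mul d fun _ => rfl]
  abel

theorem single_one_one_mul_single_zero_mul (a : A) (S : Op) : single 1 1 * (single 0 a * S) =
    single 0 (d a) * S + single 0 a * (single 1 1 * S) := by
  ext m
  simp only [coeff_add, coeff_single_one_mul, coeff_single_zero_mul, one_mul]
  change _ + d _ = d a * _ + a * (_ + d _)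
  rw [Derivation.leibniz, smul_eq_mul, smul_eq_mul]
  ring

theorem single_one_one_mul_single_zero (a : A) : (single 1 1 * single 0 a : Op) =
    single 0 (d a) + single 0 a * single 1 1 := by
  have h := single_one_one_mul_single_zero_mul (d := d) a (single 0 1)
  rwa [mul_single_zero_one, mul_single_zero_one, mul_single_zero_one] at h

/-- The coefficient of ∂S at i + 1 is Sᵢ + δ(Sᵢ₊₁), so the coefficients of S are recovered downwards
from the bound on its order. Identities involving ∂⁻¹ can thus be checked after applying ∂. -/
theorem single_one_one_mul_injective {S T : Op} (h : single 1 1 * S = single 1 1 * T) : S = T := by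
  obtain ⟨a, ha⟩ := S.bounded
  obtain ⟨b, hb⟩ := T.bounded
  have key : ∀ (n : ℕ) (i : ℤ), max a b < i + n → S.coeff i = T.coeff i := by
    intro n
    induction n with
    | zero =>
      intro i hi
      rw [ha i (by omega), hb i (by omega)]
    | succ n ih =>
      intro i hi
      have h1 := congrArg (fun X => X.coeff (i + 1)) h
      simp only [coeff_single_one_mul, one_mul, add_sub_cancel_right] at h1
      rw [ih (i + 1) (by push_cast at hi; omega)] at h1
      exact add_right_cancel h1
  ext i
  exact key (max a b + 1 - i).toNat i (by omega)

theorem single_one_one_mul_inv : (single 1 1 * single (-1) 1 : Op) = single 0 1 := by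
  ext m
  rw [coeff_single_one_mul, one_mul, one_mul, coeff_single, coeff_single, coeff_single]
  have h1 : d.toLinearMap.toAddMonoidHom (if m = -1 then (1 : A) else 0) = 0 := by
    split_ifs
    · exact d.map_one_eq_zero
    · exact map_zero _
  rw [h1, add_zero]
  exact if_congr (by omega) rfl rfl

theorem single_one_one_mul_inv_mul (S : Op) : single 1 1 * (single (-1) 1 * S) = S := by
  rw [← single_one_one_mul_mul, single_one_one_mul_inv, single_zero_one_mul]

theorem inv_mul_single_one_one_mul (S : Op) : single (-1) 1 * (single 1 1 * S) = S :=
  single_one_one_mul_injective (single_one_one_mul_inv_mul _)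

theorem inv_mul_mul (S T : Op) : single (-1) 1 * S * T = single (-1) 1 * (S * T) :=
  single_one_one_mul_injective (by
    rw [← single_one_one_mul_mul, single_one_one_mul_inv_mul, single_one_one_mul_inv_mul])

theorem mapCoeff_single (e : A →+ A) (i : ℤ) (a : A) :
    mapCoeff e (single i a : Op) = single i (e a) := by
  ext m
  rw [coeff_mapCoeff, coeff_single, coeff_single, apply_ite e, map_zero]

end Derivation

end FormalOp

namespace DiffFunField

open FormalOp

theorem derivation_one_div_sq {K : Type*} [Field K] (D : Derivation ℤ K K) {f : K} (hf : f ≠ 0) :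
    D (1 / f ^ 2) = -(2 * D f) / f ^ 3 := by
  have h := D.map_one_eq_zero
  rw [show (1 : K) = 1 / f ^ 2 * f ^ 2 by field_simp, Derivation.leibniz, pow_two] at h
  simp only [Derivation.leibniz, smul_eq_mul] at h
  field_simp at h ⊢
  linear_combination h

/-! ### The commutator identity for R -/

section RecursionOperator

variable {K : Type*} [Field K] [DiffFunField K]

theorem frechet_rhs : frechet (u 0 ^ 2 * u 2 : K) =
    single 2 (u 0 ^ 2) + single 0 (2 * u 0 * u 2) := by
  ext i
  change (if 0 ≤ i then pd i.toNat (u 0 ^ 2 * u 2 : K) else 0) = _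
  rw [coeff_add, coeff_single, coeff_single]
  by_cases hi : 0 ≤ i
  · rw [if_pos hi, pd_rhs]
    congr 1
    · exact if_congr (by omega) rfl rfl
    · exact if_congr (by omega) rfl rfl
  · rw [if_neg hi, if_neg (by omega), if_neg (by omega), add_zero]

theorem single_two_eq (a : K) : (single 2 a : PseudoDiff K) =
    single 0 a * (single 1 1 * single 1 1) := by
  ext m
  rw [coeff_single_zero_mul, coeff_single_one_mul, one_mul, one_mul, coeff_single, coeff_single,
    coeff_single]
  have h1 : (Dx K).toLinearMap.toAddMonoidHom (if m = 1 then (1 : K) else 0) = 0 := by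
    split_ifs
    · exact (Dx K).map_one_eq_zero
    · exact map_zero _
  rw [h1, add_zero, mul_ite, mul_one, mul_zero]
  exact if_congr (by omega) rfl rfl

theorem frechet_rhs_mul (S : PseudoDiff K) : frechet (u 0 ^ 2 * u 2 : K) * S =
    single 0 (u 0 ^ 2) * (single 1 1 * (single 1 1 * S)) + single 0 (2 * u 0 * u 2) * S := by
  rw [frechet_rhs, single_two_eq, right_distrib, single_zero_mul_mul, single_one_one_mul_mul]

theorem recOp_toOp : (recOp K).toOp = single 0 (u 0) * single 1 1 +
    single 0 (u 0 ^ 2 * u 2) * (single (-1) 1 * single 0 (1 / u 0 ^ 2)) := rfl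

theorem recOp_toOp_mul (S : PseudoDiff K) : (recOp K).toOp * S = single 0 (u 0) * (single 1 1 * S) +
    single 0 (u 0 ^ 2 * u 2) * (single (-1) 1 * (single 0 (1 / u 0 ^ 2) * S)) := by
  rw [recOp_toOp, right_distrib, single_zero_mul_mul, single_zero_mul_mul, inv_mul_mul]

theorem mapCoeff_Dt_single_one (F : K) (i : ℤ) :
    mapCoeff (Dt F).toLinearMap.toAddMonoidHom (single i 1 : PseudoDiff K) = 0 := by
  rw [mapCoeff_single, show (Dt F).toLinearMap.toAddMonoidHom (1 : K) = 0 from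
    (Dt F).map_one_eq_zero]
  ext j
  rw [coeff_single, ite_self, coeff_zero]

/-- `[D_F, R] = D_t(R)` for `F = u² u₂`. -/
theorem frechet_mul_recOp :
    frechet (u 0 ^ 2 * u 2 : K) * (recOp K).toOp =
      mapCoeff (Dt (u 0 ^ 2 * u 2)).toLinearMap.toAddMonoidHom (recOp K).toOp +
        (recOp K).toOp * frechet (u 0 ^ 2 * u 2 : K) := by
  have hu : (u 0 : K) ≠ 0 := u_ne_zero 0
  -- With the factor 1/u² absorbed, D_F has leading part D_x², one factor of which cancels against
  -- D_x⁻¹.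
  have hG : single 0 (1 / u 0 ^ 2) * frechet (u 0 ^ 2 * u 2 : K) =
      single 1 1 * single 1 1 + single 0 (2 * u 2 / u 0) := by
    rw [frechet_rhs, single_two_eq]
    ext m
    simp only [coeff_single_zero_mul, coeff_add, coeff_single]
    split_ifs
    · field_simp
    · rw [add_zero, add_zero]
      field_simp
  -- The function 2u₂/u is the same as in `hG`, so the two terms with D_x⁻¹ · 2u₂/u cancel.
  have hV : mapCoeff (Dt (u 0 ^ 2 * u 2)).toLinearMap.toAddMonoidHom
      (single (-1) 1 * single 0 (1 / u 0 ^ 2) : PseudoDiff K) =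
        -(single (-1) 1 * single 0 (2 * u 2 / u 0)) := by
    rw [mapCoeff_mul _ (Dt_Dx _), mapCoeff_Dt_single_one, zero_mul, zero_add, mapCoeff_single,
      ← mul_neg]
    congr 1
    ext m
    rw [coeff_neg, coeff_single, coeff_single]
    split_ifs
    · refine (derivation_one_div_sq (Dt (u 0 ^ 2 * u 2)) hu).trans ?_
      rw [Dt_u, Function.iterate_zero_apply]
      field_simp
    · exact neg_zero.symm
  have hR : mapCoeff (Dt (u 0 ^ 2 * u 2)).toLinearMap.toAddMonoidHom (recOp K).toOp =
      single 0 (Dt (u 0 ^ 2 * u 2) (u 0)) * single 1 1 +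
      (single 0 (Dt (u 0 ^ 2 * u 2) (u 0 ^ 2 * u 2)) *
        (single (-1) 1 * single 0 (1 / u 0 ^ 2)) +
      single 0 (u 0 ^ 2 * u 2) * -(single (-1) 1 * single 0 (2 * u 2 / u 0))) := by
    rw [recOp_toOp, map_add, mapCoeff_mul _ (Dt_Dx _), mapCoeff_mul _ (Dt_Dx _), hV,
      mapCoeff_Dt_single_one, mul_zero, add_zero, mapCoeff_single, mapCoeff_single]
    rfl
  rw [hR, recOp_toOp_mul, hG, frechet_rhs_mul, recOp_toOp, frechet_rhs, single_two_eq]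
  simp only [left_distrib, single_one_one_mul_single_zero_mul, single_one_one_mul_inv_mul,
    single_one_one_mul_single_zero, inv_mul_single_one_one_mul]
  -- D_t F = D_F(F) makes the coefficients of D_x⁻¹ · 1/u² agree on both sides.
  have hF : Dt (u 0 ^ 2 * u 2 : K) (u 0 ^ 2 * u 2) =
      u 0 ^ 2 * Dx K (Dx K (u 0 ^ 2 * u 2)) + 2 * u 0 * u 2 * (u 0 ^ 2 * u 2) := Dt_rhs _
  have h2 : Dx K (2 : K) = 0 := by simpa using (Dx K).map_natCast 2
  rw [hF, Dt_u, Function.iterate_zero_apply]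
  ext m
  simp only [coeff_add, coeff_neg, coeff_single_zero_mul, derivation_one_div_sq _ hu, Dx_pow_two,
    Derivation.leibniz, map_add, Dx_u, smul_eq_mul, h2, mul_zero, add_zero, coeff_single]
  -- The coefficients of the nonlocal series may be treated as unknowns; what remains is an identity
  -- in K.
  generalize (single (-1) 1 * single 0 (1 / u 0 ^ 2) : PseudoDiff K).coeff m = V
  generalize (single (-1) 1 * single 0 (2 * u 2 / u 0) : PseudoDiff K).coeff m = W
  split_ifs
  all_goals
    field_simp
    ring

/-- Since D_t R = R D_t + D_t(R), the terms in D_t agree automatically, and the part free of D_t is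
the hypothesis. -/
theorem frechetEq_mul_eq {F : K} {R : PseudoDiff K}
    (h : frechet F * R = mapCoeff (Dt F).toLinearMap.toAddMonoidHom R + R * frechet F) :
    frechetEq F * single 0 R = single 0 R * frechetEq F := by
  ext1
  funext m
  rw [coeff_single_zero_mul, frechetEq, right_distrib, coeff_add, coeff_add, coeff_single_zero_mul,
    neg_mul, coeff_neg, coeff_neg, coeff_single_one_mul]
  simp only [coeff_single, single_zero_one_mul]
  by_cases h0 : m = 0
  · subst h0
    simp [h]
  · by_cases h1 : m = 1
    · subst h1
      simp [mul_single_zero_one]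
    · simp [h0, h1, sub_eq_zero]

end RecursionOperator

end DiffFunField

theorem mainTheorem3 {K : Type*} [Field K] [DiffFunField K] :
    -- the Fréchet derivative of the right-hand side `u² u₂` is `u² D_x² + 2 u u₂`,
    frechet (u 0 ^ 2 * u 2 : K)
        = FormalOp.single 2 (u 0 ^ 2) + FormalOp.single 0 (2 * u 0 * u 2) ∧
    -- `R` commutes on solutions with the Fréchet derivative `D_Δ` of the equation,
    frechetEq (u 0 ^ 2 * u 2 : K) * FormalOp.single 0 (recOp K).toOp
        = FormalOp.single 0 (recOp K).toOp * frechetEq (u 0 ^ 2 * u 2 : K) ∧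
    -- `R` is a recursion operator with root `u² u₂` for `u_t = u² u₂`,
    IsRecursionOperator (u 0 ^ 2 * u 2 : K) (recOp K) (u 0 ^ 2 * u 2) ∧
    -- the characteristics `Q₁ = u² u₂, Q₂ = R Q₁, …` (here `Q 0, Q 1, …`) have increasing orders,
    (∀ Q : ℕ → K, Q 0 = u 0 ^ 2 * u 2 → (∀ j, (recOp K).Acts (Q j) (Q (j + 1))) →
      StrictMono fun j => order (Q j)) ∧
    -- and `Q₂ = u² (3 u₁ u₂ + u u₃)`, up to the constant of integration.
    (∀ Q₂ : K, (recOp K).Acts (u 0 ^ 2 * u 2) Q₂ ↔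
      ∃ c : K, Dx K c = 0 ∧
        Q₂ = u 0 ^ 2 * (3 * u 1 * u 2 + u 0 * u 3) + c * (u 0 ^ 2 * u 2)) := by
  exact ⟨frechet_rhs, frechetEq_mul_eq frechet_mul_recOp, isRecursionOperator_recOp,
    fun _ => strictMono_order, recOp_acts_root_iff⟩
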